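/- Let $K$ be an algebraically closed field that is complete with respect to a nontrivial nonarchimedean absolute value $|\cdot|$, and let $\|x\|=\max_i|x_i|$ on $K^{N+1}$. Equip $\mathbb{P}^N(K)$ with the chordal metric $$\Delta(P,Q)=\frac{\max_{i,j}|x_iy_j-x_jy_i|}{\|x\|\,\|y\|}\qquad\text{for } P=(x_0:\cdots:x_N),\ Q=(y_0:\cdots:y_N),$$ and put $D_r(P)=\{Q:\Delta(P,Q)<r\}$. Let $\varphi:\mathbb{P}^N\to\mathbb{P}^N$ be a morphism over $K$ of degree $d\ge 2$. A lift of $\varphi$ is a tuple $\Phi=(\Phi_0,\dots,\Phi_N)$ of homogeneous polynomials of degree $d$ over $K$, without common zero in $K^{N+1}\setminus\{0\}$, that induces $\varphi$. Write $\|\Phi\|$ for the maximum of the absolute values of the coefficients of $\Phi$; the lift is minimal if $\|\Phi\|=1$. Let $\Phi$ be a minimal lift of $\varphi$, and let $|\operatorname{Res}(\varphi)|=|\operatorname{Res}(\Phi)|$ be the absolute value of its Macaulay resultant. Define $$\hat g_\Phi(P)=\lim_{n\to\infty}\frac1{d^n}\log\|\Phi^n(x)\|-\log\|x\|,$$ where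 $x$ is any lift of $P$; the limit exists, and the value does not depend on $x$. The morphism $\varphi$ has good reduction at $P$ if there are a lift $\Psi$ of $\varphi$ and a lift $x$ of $P$ with $\|x\|=\|\Psi\|=\|\Psi(x)\|=1$, and bad reduction at $P$ otherwise. It has orbital good reduction at $P$ if it has good reduction at $\varphi^n(P)$ for all $n\ge 0$. Let $U^{\mathrm{orb}}(\varphi)$ be the set of points of orbital good reduction. The Fatou set $\mathcal F(\varphi)$ is the union of all open subsets of $\mathbb{P}^N(K)$ at every point of which the family $\{\varphi^n\}_{n\ge1}$ is equicontinuous for $\Delta$. Then: (a) If $P\in U^{\mathrm{orb}}(\varphi)$ and $Q,R\in D_{|\operatorname{Res}(\varphi)|}(P)$, then $\Delta(\varphi^n(Q),\varphi^n(R))\le\Delta(Q,R)$ for all $n\ge1$. (b) If $P\in U^{\mathrm{orb}}(\varphi)$, then $D_{|\operatorname{Res}(\varphi)|}(P)\subseteq U^{\mathrm{orb}}(\varphi)$. Moreover, $U^{\mathrm{orb}}(\varphi)$ is open. (c) $U^{\mathrm{orb}}(\varphi)=\{P\in\mathbb{P}^N(K):\hat g_\Phi(P)=0\}\subseteq\mathcal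 F(\varphi)$. (d) $\hat g_\Phi(P)<0$ at every point $P$ of bad reduction. (e) The set $\{P\in\mathbb{P}^N(K):\hat g_\Phi(P)=0\}$ is open. -/

import Mathlib

open Filter Topology LinearAlgebra.Projectivization

noncomputable section

namespace ProjDyn

/-! ### The chordal metric on projective space -/

/-- The set `ℙ^N(K)`. -/
abbrev PSpace (K : Type*) [Field K] (N : ℕ) : Type _ := ℙ K (Fin (N + 1) → K)

/-- `max_{i,j} |x_i y_j - x_j y_i| / (‖x‖ ‖y‖)`; all norms are sup norms. -/
def chordalVec {K : Type*} [NormedField K] {N : ℕ} (x y : Fin (N + 1) → K) : ℝ :=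
  ‖(fun p : Fin (N + 1) × Fin (N + 1) => x p.1 * y p.2 - x p.2 * y p.1)‖ / (‖x‖ * ‖y‖)

lemma chordalVec_smul_smul {K : Type*} [NormedField K] {N : ℕ} (x y : Fin (N + 1) → K)
    {a b : K} (ha : a ≠ 0) (hb : b ≠ 0) :
    chordalVec (a • x) (b • y) = chordalVec x y := by
  have h : (fun p : Fin (N + 1) × Fin (N + 1) =>
      (a • x) p.1 * (b • y) p.2 - (a • x) p.2 * (b • y) p.1)
      = (a * b) • (fun p : Fin (N + 1) × Fin (N + 1) => x p.1 * y p.2 - x p.2 * y p.1) := by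
    funext p
    simp only [Pi.smul_apply, smul_eq_mul]
    ring
  have ha' : ‖a‖ ≠ 0 := norm_ne_zero_iff.mpr ha
  have hb' : ‖b‖ ≠ 0 := norm_ne_zero_iff.mpr hb
  unfold chordalVec
  rw [h, norm_smul, norm_smul, norm_smul, norm_mul,
    show ‖a‖ * ‖x‖ * (‖b‖ * ‖y‖) = (‖a‖ * ‖b‖) * (‖x‖ * ‖y‖) by ring,
    mul_div_mul_left _ _ (mul_ne_zero ha' hb')]

/-- The chordal distance on `ℙ^N(K)`, computed on lifts of the two points. -/
def chordalDist {K : Type*} [NormedField K] {N : ℕ} (P Q : PSpace K N) : ℝ :=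
  chordalVec P.rep Q.rep

lemma chordalDist_mk {K : Type*} [NormedField K] {N : ℕ} (x y : Fin (N + 1) → K)
    (hx : x ≠ 0) (hy : y ≠ 0) :
    chordalDist (Projectivization.mk K x hx) (Projectivization.mk K y hy) = chordalVec x y := by
  obtain ⟨a, ha⟩ := Projectivization.exists_smul_eq_mk_rep K x hx
  obtain ⟨b, hb⟩ := Projectivization.exists_smul_eq_mk_rep K y hy
  unfold chordalDist
  rw [← ha, ← hb]
  exact chordalVec_smul_smul x y a.ne_zero b.ne_zero

lemma chordalVec_triangle {K : Type*} [NormedField K] [IsUltrametricDist K] {N : ℕ}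
    (x y z : Fin (N + 1) → K) (hx : x ≠ 0) (hy : y ≠ 0) (hz : z ≠ 0) :
    chordalVec x z ≤ max (chordalVec x y) (chordalVec y z) := by
  have hx' : 0 < ‖x‖ := norm_pos_iff.mpr hx
  have hy' : 0 < ‖y‖ := norm_pos_iff.mpr hy
  have hz' : 0 < ‖z‖ := norm_pos_iff.mpr hz
  set M := max (chordalVec x y) (chordalVec y z) with hM
  have key : ∀ (u v : Fin (N + 1) → K), 0 < ‖u‖ → 0 < ‖v‖ → chordalVec u v ≤ M →
      ∀ i j, ‖u i * v j - u j * v i‖ ≤ M * (‖u‖ * ‖v‖) := by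
    intro u v hu hv h i j
    refine le_trans (norm_le_pi_norm
      (fun p : Fin (N + 1) × Fin (N + 1) => u p.1 * v p.2 - u p.2 * v p.1) (i, j)) ?_
    exact (div_le_iff₀ (mul_pos hu hv)).mp h
  have hxy := key x y hx' hy' (le_max_left _ _)
  have hyz := key y z hy' hz' (le_max_right _ _)
  have hM0 : 0 ≤ M := le_trans (by unfold chordalVec; positivity) (le_max_left _ _)
  obtain ⟨j, hj⟩ : ∃ j, ‖y j‖ = ‖y‖ := by
    obtain ⟨j, -, hj⟩ := Finset.exists_mem_eq_sup' (Finset.univ_nonempty (α := Fin (N + 1)))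
      (fun i => ‖y i‖₊)
    refine ⟨j, ?_⟩
    rw [Pi.norm_def, ← Finset.sup'_eq_sup Finset.univ_nonempty, hj]
    rfl
  unfold chordalVec
  rw [div_le_iff₀ (mul_pos hx' hz')]
  refine (pi_norm_le_iff_of_nonneg (by positivity)).mpr ?_
  rintro ⟨i, k⟩
  have e : (x i * z k - x k * z i) * y j
      = (x i * y j - x j * y i) * z k + (y i * z k - y k * z i) * x j
        + (x j * y k - x k * y j) * z i := by ring
  have b : ∀ (s : K) (c : Fin (N + 1) → K) (l : Fin (N + 1)) (C : ℝ), 0 ≤ C →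
      ‖s‖ ≤ C → ‖s * c l‖ ≤ C * ‖c‖ := by
    intro s c l C hC hs
    rw [norm_mul]
    exact mul_le_mul hs (norm_le_pi_norm c l) (norm_nonneg _) hC
  have h1 := b _ z k _ (by positivity) (hxy i j)
  have h2 := b _ x j _ (by positivity) (hyz i k)
  have h3 := b _ z i _ (by positivity) (hxy j k)
  have h4 : ‖(x i * z k - x k * z i) * y j‖ ≤ M * (‖x‖ * ‖z‖) * ‖y‖ := by
    rw [e]
    refine le_trans (IsUltrametricDist.norm_add_le_max _ _)
      (max_le (le_trans (IsUltrametricDist.norm_add_le_max _ _) (max_le ?_ ?_)) ?_)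
    · linarith
    · linarith
    · linarith
  rw [norm_mul, hj] at h4
  exact le_of_mul_le_mul_right h4 hy'

/-- `ℙ^N(K)` carries the metric given by the chordal distance. -/
instance instMetricSpacePSpace {K : Type*} [NormedField K] [IsUltrametricDist K] {N : ℕ} :
    MetricSpace (PSpace K N) where
  dist := chordalDist
  dist_self P := by
    simp [chordalDist, chordalVec, mul_comm, Pi.norm_def]
  dist_comm P Q := by
    unfold chordalDist chordalVec
    rw [mul_comm ‖P.rep‖, ← norm_neg]
    congr 2
    funext p
    simp only [Pi.neg_apply]
    ring
  dist_triangle P Q R := by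
    refine le_trans (chordalVec_triangle P.rep Q.rep R.rep P.rep_nonzero Q.rep_nonzero
      R.rep_nonzero) (max_le_add_of_nonneg ?_ ?_)
    · unfold chordalVec; positivity
    · unfold chordalVec; positivity
  eq_of_dist_eq_zero := by
    intro P Q h
    have hP : ‖P.rep‖ ≠ 0 := norm_ne_zero_iff.mpr P.rep_nonzero
    have hQ : ‖Q.rep‖ ≠ 0 := norm_ne_zero_iff.mpr Q.rep_nonzero
    have h' : chordalVec P.rep Q.rep = 0 := h
    unfold chordalVec at h'
    rw [div_eq_zero_iff, or_iff_left (mul_ne_zero hP hQ), norm_eq_zero] at h'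
    obtain ⟨j, hj⟩ := Function.ne_iff.mp Q.rep_nonzero
    rw [← P.mk_rep, ← Q.mk_rep, Projectivization.mk_eq_mk_iff']
    refine ⟨P.rep j / Q.rep j, ?_⟩
    funext i
    have hij := congrFun h' (i, j)
    simp only [Pi.zero_apply] at hij hj
    simp only [Pi.smul_apply, smul_eq_mul]
    field_simp
    linear_combination -hij

/-! ### Morphisms of projective space and their lifts -/

/-- An `(N+1)`-tuple of polynomials in the variables `X_0, …, X_N`. -/
abbrev PolyMap (K : Type*) [Field K] (N : ℕ) : Type _ :=
  Fin (N + 1) → MvPolynomial (Fin (N + 1)) K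

/-- The induced map `K^{N+1} → K^{N+1}`. -/
def PolyMap.app {K : Type*} [Field K] {N : ℕ} (Φ : PolyMap K N) (x : Fin (N + 1) → K) :
    Fin (N + 1) → K :=
  fun i => MvPolynomial.eval x (Φ i)

/-- `Φ` is a degree `d` lift of the self-map `f` of `ℙ^N(K)`: its components are homogeneous of
degree `d` without a nontrivial common zero, and `f(π(x)) = π(Φ(x))`. -/
structure IsLift {K : Type*} [Field K] {N : ℕ} (d : ℕ) (Φ : PolyMap K N)
    (f : PSpace K N → PSpace K N) : Prop where
  homogeneous : ∀ i, (Φ i).IsHomogeneous d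
  app_ne_zero : ∀ x, x ≠ 0 → Φ.app x ≠ 0
  map_mk : ∀ (x : Fin (N + 1) → K) (hx : x ≠ 0),
    f (Projectivization.mk K x hx) = Projectivization.mk K (Φ.app x) (app_ne_zero x hx)

/-- Morphisms `ℙ^N → ℙ^N` of degree `d` over the algebraically closed field `K`, as maps on
`K`-points. -/
structure ProjMorphism (K : Type*) [Field K] (N d : ℕ) where
  toFun : PSpace K N → PSpace K N
  exists_lift : ∃ Φ : PolyMap K N, IsLift d Φ toFun

instance instCoeFunProjMorphism {K : Type*} [Field K] {N d : ℕ} :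
    CoeFun (ProjMorphism K N d) (fun _ => PSpace K N → PSpace K N) :=
  ⟨ProjMorphism.toFun⟩

/-- A minimal lift: all coefficients have absolute value at most `1`, and one of them is a unit. -/
structure IsMinimalLift {K : Type*} [NormedField K] {N d : ℕ} (φ : ProjMorphism K N d)
    (Φ : PolyMap K N) : Prop where
  isLift : IsLift d Φ φ
  integral : ∀ i m, ‖(Φ i).coeff m‖ ≤ 1
  exists_unit : ∃ i m, ‖(Φ i).coeff m‖ = 1

/-- `‖Φ‖`, the maximum of the absolute values of all coefficients of `Φ`. -/
def PolyMap.coeffNorm {K : Type*} [NormedField K] {N : ℕ} (Φ : PolyMap K N) : ℝ :=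
  ((Finset.univ.sup fun i => (Φ i).support.sup fun m => ‖(Φ i).coeff m‖₊ : NNReal) : ℝ)

/-! ### The Macaulay resultant

Let `F_0, …, F_N` be the generic forms of degree `d` in `X_0, …, X_N`, with coefficients in the
ring `ℤ[u]` of the universal coefficients `u_{i,α}`. For `t = (N+1)(d-1)+1`, the resultant is the
greatest common divisor in `ℤ[u]` of the maximal minors of the matrix of
`(G_0, …, G_N) ↦ ∑ G_i F_i`, from `(N+1)`-tuples of forms of degree `t - d = N(d-1)` to forms of
degree `t`, with the sign chosen so that `X_0^d, …, X_N^d` has resultant `1`. -/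

/-- Exponent vectors of the monomials of degree `t` in `X_0, …, X_N`. -/
abbrev Mon (N t : ℕ) : Type :=
  {m : Fin (N + 1) →₀ ℕ // m ∈ (Finset.univ : Finset (Fin (N + 1))).finsuppAntidiag t}

/-- The ring `ℤ[u_{i,α}]` of universal coefficients. -/
abbrev UnivCoeff (N d : ℕ) : Type := MvPolynomial (Fin (N + 1) × Mon N d) ℤ

/-- The generic form `F_i = ∑_α u_{i,α} X^α` of degree `d`. -/
def genericForm (N d : ℕ) (i : Fin (N + 1)) : MvPolynomial (Fin (N + 1)) (UnivCoeff N d) :=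
  ∑ α : Mon N d, MvPolynomial.monomial α.1 (MvPolynomial.X (i, α))

/-- The column `(i, β)` holds the coefficients of `X^β F_i`. -/
def macaulayMatrix (N d : ℕ) :
    Matrix (Mon N ((N + 1) * (d - 1) + 1)) (Fin (N + 1) × Mon N (N * (d - 1))) (UnivCoeff N d) :=
  fun m c => (MvPolynomial.monomial c.2.1 1 * genericForm N d c.1).coeff m.1

/-- The greatest common divisor of the maximal minors (defined up to sign). -/
def macaulayGcd (N d : ℕ) : UnivCoeff N d :=
  letI : StrongNormalizationMonoid (UnivCoeff N d) :=
    UniqueFactorizationMonoid.strongNormalizationMonoid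
  letI : NormalizedGCDMonoid (UnivCoeff N d) :=
    UniqueFactorizationMonoid.toNormalizedGCDMonoid (UnivCoeff N d)
  (Finset.univ : Finset
      (Mon N ((N + 1) * (d - 1) + 1) → Fin (N + 1) × Mon N (N * (d - 1)))).gcd
    fun s => ((macaulayMatrix N d).submatrix id s).det

/-- The value (`1` or `-1`) of `macaulayGcd` at the system `X_0^d, …, X_N^d`. -/
def macaulaySign (N d : ℕ) : ℤ :=
  MvPolynomial.eval
    (fun c : Fin (N + 1) × Mon N d => if c.2.1 = Finsupp.single c.1 d then 1 else 0)
    (macaulayGcd N d)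

/-- The Macaulay resultant of `N+1` forms of degree `d`, as a polynomial in their coefficients. -/
def macaulayResultant (N d : ℕ) : UnivCoeff N d :=
  MvPolynomial.C (macaulaySign N d) * macaulayGcd N d

/-- The resultant `Res(Φ)` of `N+1` forms of degree `d` over `K`. -/
def PolyMap.res {K : Type*} [Field K] {N : ℕ} (d : ℕ) (Φ : PolyMap K N) : K :=
  MvPolynomial.eval₂ (Int.castRingHom K)
    (fun c : Fin (N + 1) × Mon N d => (Φ c.1).coeff c.2.1) (macaulayResultant N d)

/-! ### Green functions, good reduction, and the Fatou set -/

/-- The Green function `G_Φ(x) = lim_n d^{-n} log ‖Φ^n(x)‖`. -/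
def greenFunction {K : Type*} [NormedField K] {N : ℕ} (d : ℕ) (Φ : PolyMap K N)
    (x : Fin (N + 1) → K) : ℝ :=
  limUnder atTop fun n : ℕ => Real.log ‖Φ.app^[n] x‖ / (d : ℝ) ^ n

/-- The modified Green function `ĝ_Φ(P) = G_Φ(x) - log ‖x‖`, for a lift `x` of `P`. -/
def modifiedGreen {K : Type*} [NormedField K] {N : ℕ} (d : ℕ) (Φ : PolyMap K N)
    (P : PSpace K N) : ℝ :=
  greenFunction d Φ P.rep - Real.log ‖P.rep‖

/-- Good reduction at `P`: some lift `Φ` of `φ` and some lift `x` of `P` satisfy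
`‖x‖ = ‖Φ‖ = ‖Φ(x)‖ = 1`. -/
def HasGoodReductionAt {K : Type*} [NormedField K] {N d : ℕ} (φ : ProjMorphism K N d)
    (P : PSpace K N) : Prop :=
  ∃ (Φ : PolyMap K N) (x : Fin (N + 1) → K) (hx : x ≠ 0), IsLift d Φ φ ∧
    Projectivization.mk K x hx = P ∧ ‖x‖ = 1 ∧ Φ.coeffNorm = 1 ∧ ‖Φ.app x‖ = 1

def goodSet {K : Type*} [NormedField K] {N d : ℕ} (φ : ProjMorphism K N d) : Set (PSpace K N) :=
  {P | HasGoodReductionAt φ P}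

def badSet {K : Type*} [NormedField K] {N d : ℕ} (φ : ProjMorphism K N d) : Set (PSpace K N) :=
  (goodSet φ)ᶜ

/-- The points all of whose forward iterates (including the point itself) are points of good
reduction. -/
def orbitalGoodSet {K : Type*} [NormedField K] {N d : ℕ} (φ : ProjMorphism K N d) :
    Set (PSpace K N) :=
  {P | ∀ n : ℕ, φ^[n] P ∈ goodSet φ}

/-- The union of all open sets on which `φ, φ^2, φ^3, …` is equicontinuous for the chordal
metric. -/
def fatouSet {K : Type*} [NormedField K] [IsUltrametricDist K] {N d : ℕ}
    (φ : ProjMorphism K N d) : Set (PSpace K N) :=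
  ⋃₀ {U | IsOpen U ∧ ∀ P ∈ U, EquicontinuousAt (fun n : ℕ+ => φ^[(n : ℕ)]) P}

end ProjDyn

end

/-! For a minimal lift the strong triangle inequality gives `‖Φ(x)‖ ≤ ‖x‖ ^ d` and makes `Φ`
1-Lipschitz on the unit polydisc. A lift is unique up to a scalar (`IsLift.exists_eq_C_mul`), so
good reduction at `[x]` means equality `‖Φ(x)‖ = ‖x‖ ^ d` for this one `Φ`
(`hasGoodReductionAt_mk_iff`).

Points at chordal distance less than 1 have unit lifts equally close. Hence good reduction at the
centre spreads to the open unit disc, and `φ` does not increase distances to the centre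
(`IsMinimalLift.good_and_dist_le`). Iterating and recentring gives (a), (b) and the Fatou inclusion
on discs of radius 1. The resultant enters only through `|Res| ≤ 1`.

The sequence `log ‖Φ^n(x)‖ / d ^ n` starts at `log ‖x‖` and decreases; a lower bound `ε ‖x‖ ^ d ≤
‖Φ(x)‖` from the Nullstellensatz makes it converge. Its `n`-th step is an equality exactly when
`φ^n(P)` is good, so the limit is `log ‖x‖` iff the whole orbit is good. -/

namespace ProjDyn

variable {K : Type*} {N d : ℕ}

/-! ### Homogeneity and iteration of lifts -/

section Field

variable [Field K]

lemma sum_eq_of_coeff_ne_zero {p : MvPolynomial (Fin (N + 1)) K} (hp : p.IsHomogeneous d)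
    {m : Fin (N + 1) →₀ ℕ} (hm : p.coeff m ≠ 0) : ∑ i, m i = d := by
  have h := hp hm
  rw [← h]
  simp [Finsupp.weight_apply, Finsupp.sum_fintype]

lemma eval_smul_of_isHomogeneous {p : MvPolynomial (Fin (N + 1)) K} (hp : p.IsHomogeneous d)
    (c : K) (x : Fin (N + 1) → K) :
    MvPolynomial.eval (c • x) p = c ^ d * MvPolynomial.eval x p := by
  rw [MvPolynomial.eval_eq', MvPolynomial.eval_eq', Finset.mul_sum]
  refine Finset.sum_congr rfl fun m hm => ?_
  rw [← sum_eq_of_coeff_ne_zero hp (MvPolynomial.mem_support_iff.mp hm)]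
  simp only [Pi.smul_apply, smul_eq_mul, mul_pow, Finset.prod_mul_distrib,
    Finset.prod_pow_eq_pow_sum]
  ring

lemma PolyMap.app_smul {Φ : PolyMap K N} (hΦ : ∀ i, (Φ i).IsHomogeneous d) (c : K)
    (x : Fin (N + 1) → K) : Φ.app (c • x) = c ^ d • Φ.app x := by
  funext i
  exact eval_smul_of_isHomogeneous (hΦ i) c x

lemma PolyMap.iterate_app_smul {Φ : PolyMap K N} (hΦ : ∀ i, (Φ i).IsHomogeneous d) (c : K)
    (x : Fin (N + 1) → K) (n : ℕ) : Φ.app^[n] (c • x) = c ^ d ^ n • Φ.app^[n] x := by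
  induction n with
  | zero => simp
  | succ n ih =>
    rw [Function.iterate_succ_apply', ih, PolyMap.app_smul hΦ, Function.iterate_succ_apply',
      ← pow_mul, ← pow_succ]

lemma IsLift.iterate_app_ne_zero {Φ : PolyMap K N} {f : PSpace K N → PSpace K N}
    (h : IsLift d Φ f) {x : Fin (N + 1) → K} (hx : x ≠ 0) (n : ℕ) : Φ.app^[n] x ≠ 0 := by
  induction n with
  | zero => exact hx
  | succ n ih =>
    rw [Function.iterate_succ_apply']
    exact h.app_ne_zero _ ih

lemma IsLift.iterate_mk {Φ : PolyMap K N} {f : PSpace K N → PSpace K N}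
    (h : IsLift d Φ f) {x : Fin (N + 1) → K} (hx : x ≠ 0) (n : ℕ) :
    f^[n] (Projectivization.mk K x hx)
      = Projectivization.mk K (Φ.app^[n] x) (h.iterate_app_ne_zero hx n) := by
  induction n with
  | zero => rfl
  | succ n ih =>
    rw [Function.iterate_succ_apply', ih, h.map_mk]
    simp only [Function.iterate_succ_apply']

/-! ### Uniqueness of lifts up to a scalar -/

/-- Univariate polynomials over an algebraically closed field without a common root generate the
unit ideal. -/
lemma exists_sum_mul_eq_one [IsAlgClosed K] {ι : Type*} [Fintype ι] (p : ι → Polynomial K)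
    (hp : ∀ t, ∃ i, (p i).eval t ≠ 0) : ∃ r : ι → Polynomial K, ∑ i, r i * p i = 1 := by
  obtain ⟨g, hg⟩ := IsPrincipalIdealRing.principal (Ideal.span (Set.range p))
  have hdvd : ∀ i, g ∣ p i := fun i => by
    have : p i ∈ Ideal.span (Set.range p) := Ideal.subset_span ⟨i, rfl⟩
    rw [hg] at this
    exact Ideal.mem_span_singleton.mp this
  -- A root of the generator would be a common root of all `p i`. The case `g = 0`, of degree `⊥`,
  -- is covered too.
  have hdeg : g.degree = 0 := by
    by_contra h
    obtain ⟨t, ht⟩ := IsAlgClosed.exists_root g h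
    obtain ⟨i, hi⟩ := hp t
    obtain ⟨q, hq⟩ := hdvd i
    exact hi (by rw [hq, Polynomial.eval_mul, ht.eq_zero, zero_mul])
  have h1 : (1 : Polynomial K) ∈ Ideal.span (Set.range p) := by
    rw [hg]
    exact Ideal.mem_span_singleton.mpr (Polynomial.isUnit_iff_degree_eq_zero.mpr hdeg).dvd
  exact Ideal.mem_span_range_iff_exists_fun.mp h1

/-- Two proportional tuples of univariate polynomials, both without a common root, differ by a
constant factor. -/
lemma exists_eq_C_mul_of_proportional [IsAlgClosed K] {ι : Type*} [Fintype ι]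
    (p q : ι → Polynomial K)
    (hp : ∀ t, ∃ i, (p i).eval t ≠ 0) (hq : ∀ t, ∃ i, (q i).eval t ≠ 0)
    (hpq : ∀ i j, q i * p j = q j * p i) :
    ∃ c : K, ∀ i, q i = Polynomial.C c * p i := by
  obtain ⟨r, hr⟩ := exists_sum_mul_eq_one p hp
  obtain ⟨s, hs⟩ := exists_sum_mul_eq_one q hq
  -- Bézout for `p` produces the polynomial cofactor; Bézout for `q` then shows that it is a unit,
  -- hence constant.
  have h1 : ∀ i, q i = (∑ j, r j * q j) * p i := fun i => by
    calc q i = q i * ∑ j, r j * p j := by rw [hr, mul_one]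
      _ = _ := by
        rw [Finset.mul_sum, Finset.sum_mul]
        exact Finset.sum_congr rfl fun j _ => by linear_combination r j * hpq i j
  have h2 : (∑ j, s j * p j) * (∑ j, r j * q j) = 1 := by
    rw [← hs, Finset.sum_mul]
    exact Finset.sum_congr rfl fun j _ => by rw [h1 j]; ring
  obtain ⟨c, -, hc⟩ := Polynomial.isUnit_iff.mp (IsUnit.of_mul_eq_one_right _ h2)
  exact ⟨c, fun i => by rw [hc]; exact h1 i⟩

/-- On a line missing the origin both lifts become tuples of univariate polynomials without common
root, pointwise proportional because they induce the same map. -/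
lemma exists_smul_app_eq_on_line [IsAlgClosed K] {Φ Ψ : PolyMap K N}
    {f : PSpace K N → PSpace K N} (hΦ : IsLift d Φ f) (hΨ : IsLift d Ψ f)
    {x y : Fin (N + 1) → K} (hxy : ∀ t : K, x + t • y ≠ 0) :
    ∃ c : K, ∀ t : K, Ψ.app (x + t • y) = c • Φ.app (x + t • y) := by
  let line : PolyMap K N → Fin (N + 1) → Polynomial K := fun Θ i =>
    MvPolynomial.aeval (fun k => Polynomial.C (x k) + Polynomial.X * Polynomial.C (y k)) (Θ i)
  have heval : ∀ Θ i t, (line Θ i).eval t = Θ.app (x + t • y) i := fun Θ i t => by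
    change Polynomial.eval t (MvPolynomial.aeval _ (Θ i)) = MvPolynomial.eval _ (Θ i)
    rw [← Polynomial.coe_aeval_eq_eval, MvPolynomial.comp_aeval_apply, MvPolynomial.aeval_def,
      ← MvPolynomial.eval₂_id]
    simp [MvPolynomial.eval₂_eq', mul_comm t]
  have hne : ∀ Θ : PolyMap K N, IsLift d Θ f → ∀ t, ∃ i, (line Θ i).eval t ≠ 0 :=
    fun Θ hΘ t => by
      obtain ⟨i, hi⟩ := Function.ne_iff.mp (hΘ.app_ne_zero _ (hxy t))
      exact ⟨i, by rw [heval]; exact hi⟩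
  have hprop : ∀ i j, line Ψ i * line Φ j = line Ψ j * line Φ i := fun i j => by
    refine Polynomial.funext fun t => ?_
    rw [Polynomial.eval_mul, Polynomial.eval_mul, heval, heval, heval, heval]
    have h := (hΨ.map_mk _ (hxy t)).symm.trans (hΦ.map_mk _ (hxy t))
    obtain ⟨a, ha⟩ := (Projectivization.mk_eq_mk_iff' K _ _ _ _).mp h
    rw [← ha]
    simp only [Pi.smul_apply, smul_eq_mul]
    ring
  obtain ⟨c, hc⟩ := exists_eq_C_mul_of_proportional (line Φ) (line Ψ) (hne Φ hΦ) (hne Ψ hΨ) hprop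
  refine ⟨c, fun t => funext fun i => ?_⟩
  rw [← heval, hc, Polynomial.eval_mul, Polynomial.eval_C, heval, Pi.smul_apply, smul_eq_mul]

/-- A lift is determined by the morphism up to a scalar. -/
lemma IsLift.exists_eq_C_mul [IsAlgClosed K] {Φ Ψ : PolyMap K N}
    {f : PSpace K N → PSpace K N} (hΦ : IsLift d Φ f) (hΨ : IsLift d Ψ f) :
    ∃ c : K, ∀ i, Ψ i = MvPolynomial.C c * Φ i := by
  have hone : (1 : Fin (N + 1) → K) ≠ 0 := one_ne_zero
  obtain ⟨c, hc⟩ := (Projectivization.mk_eq_mk_iff' K _ _ _ _).mp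
    ((hΨ.map_mk _ hone).symm.trans (hΦ.map_mk _ hone))
  -- The constant is fixed at `(1, …, 1)`. Homogeneity carries it to multiples of that vector; any
  -- other `x` is joined to it by a line missing the origin, where the ratio is constant.
  have key : ∀ x, Ψ.app x = c • Φ.app x := fun x => by
    by_cases hx : ∃ a : K, a • (1 : Fin (N + 1) → K) = x
    · obtain ⟨a, rfl⟩ := hx
      rw [PolyMap.app_smul hΨ.homogeneous, PolyMap.app_smul hΦ.homogeneous, ← hc, smul_comm]
    · have hline : ∀ t : K, (1 : Fin (N + 1) → K) + t • (x - 1) ≠ 0 := fun t ht => by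
        by_cases ht0 : t = 0
        · simp [ht0] at ht
        · refine hx ⟨1 - t⁻¹, ?_⟩
          funext i
          have := congrFun ht i
          simp only [Pi.add_apply, Pi.one_apply, Pi.smul_apply, Pi.sub_apply, smul_eq_mul,
            Pi.zero_apply] at this
          simp only [Pi.smul_apply, Pi.one_apply, smul_eq_mul, mul_one]
          field_simp
          linear_combination -this
      obtain ⟨b, hb⟩ := exists_smul_app_eq_on_line hΦ hΨ hline
      have hb0 := hb 0
      have hb1 := hb 1
      simp only [zero_smul, add_zero, one_smul, add_sub_cancel] at hb0 hb1
      rw [← hc] at hb0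
      rw [hb1, smul_left_injective K (hΦ.app_ne_zero _ hone) hb0]
  have : Infinite K := IsAlgClosed.instInfinite
  refine ⟨c, fun i => MvPolynomial.funext fun x => ?_⟩
  rw [map_mul, MvPolynomial.eval_C]
  exact congrFun (key x) i

end Field

/-! ### Unit lifts, coefficient norms and the test for good reduction -/

section NormedField

variable [NormedField K]

lemma exists_norm_apply_eq (x : Fin (N + 1) → K) : ∃ j, ‖x j‖ = ‖x‖ := by
  obtain ⟨j, -, hj⟩ := Finset.exists_mem_eq_sup' (Finset.univ_nonempty (α := Fin (N + 1)))
    (fun i => ‖x i‖₊)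
  refine ⟨j, ?_⟩
  rw [Pi.norm_def, ← Finset.sup'_eq_sup Finset.univ_nonempty, hj]
  rfl

/-- The sup norm is attained at a coordinate, so it is the absolute value of a scalar by which one
can divide. -/
lemma exists_norm_smul_eq_one {x : Fin (N + 1) → K} (hx : x ≠ 0) :
    ∃ c : K, c ≠ 0 ∧ ‖c • x‖ = 1 := by
  obtain ⟨j, hj⟩ := exists_norm_apply_eq x
  have hx' : ‖x‖ ≠ 0 := norm_ne_zero_iff.mpr hx
  refine ⟨(x j)⁻¹, inv_ne_zero (norm_ne_zero_iff.mp (hj ▸ hx')), ?_⟩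
  rw [norm_smul, norm_inv, hj, inv_mul_cancel₀ hx']

lemma exists_mk_eq_norm_eq_one (P : PSpace K N) :
    ∃ (x : Fin (N + 1) → K) (hx : x ≠ 0), Projectivization.mk K x hx = P ∧ ‖x‖ = 1 := by
  obtain ⟨c, hc, h⟩ := exists_norm_smul_eq_one P.rep_nonzero
  refine ⟨c • P.rep, smul_ne_zero hc P.rep_nonzero, ?_, h⟩
  conv_rhs => rw [← P.mk_rep]
  exact (Projectivization.mk_eq_mk_iff' K _ _ _ _).mpr ⟨c, rfl⟩

lemma norm_prod_pow_le {x : Fin (N + 1) → K} (m : Fin (N + 1) →₀ ℕ) :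
    ‖∏ i, x i ^ m i‖ ≤ ‖x‖ ^ ∑ i, m i := by
  rw [norm_prod, ← Finset.prod_pow_eq_pow_sum]
  refine Finset.prod_le_prod (fun i _ => norm_nonneg _) fun i _ => ?_
  rw [norm_pow]
  exact pow_le_pow_left₀ (norm_nonneg _) (norm_le_pi_norm x i) _

lemma coeffNorm_C_mul {Φ Ψ : PolyMap K N} {c : K} (h : ∀ i, Ψ i = MvPolynomial.C c * Φ i) :
    Ψ.coeffNorm = ‖c‖ * Φ.coeffNorm := by
  unfold PolyMap.coeffNorm
  rw [← coe_nnnorm, ← NNReal.coe_mul, NNReal.mul_finset_sup]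
  congr 2
  funext i
  rw [NNReal.mul_finset_sup, h i]
  by_cases hc : c = 0
  · simp only [hc, map_zero, zero_mul, MvPolynomial.support_zero, Finset.sup_empty, nnnorm_zero]
    exact (Finset.sup_bot _).symm
  · have hs : (MvPolynomial.C c * Φ i).support = (Φ i).support := by
      ext m
      simp [MvPolynomial.mem_support_iff, MvPolynomial.coeff_C_mul, hc]
    rw [hs]
    refine congrArg _ (funext fun m => ?_)
    rw [MvPolynomial.coeff_C_mul, nnnorm_mul]

lemma IsMinimalLift.coeffNorm_eq_one {φ : ProjMorphism K N d} {Φ : PolyMap K N}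
    (hΦ : IsMinimalLift φ Φ) : Φ.coeffNorm = 1 := by
  unfold PolyMap.coeffNorm
  refine NNReal.coe_eq_one.mpr (le_antisymm ?_ ?_)
  · exact Finset.sup_le fun i _ => Finset.sup_le fun m _ => hΦ.integral i m
  · obtain ⟨i, m, h⟩ := hΦ.exists_unit
    have hm : m ∈ (Φ i).support := MvPolynomial.mem_support_iff.mpr fun h0 => by
      simp [h0] at h
    calc (1 : NNReal) = ‖(Φ i).coeff m‖₊ := NNReal.eq h.symm
      _ ≤ (Φ i).support.sup fun m => ‖(Φ i).coeff m‖₊ :=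
        Finset.le_sup (f := fun m => ‖(Φ i).coeff m‖₊) hm
      _ ≤ _ := Finset.le_sup (f := fun i => (Φ i).support.sup fun m => ‖(Φ i).coeff m‖₊)
        (Finset.mem_univ i)

/-- Good reduction can be tested on one minimal lift and on any lift of the point. -/
lemma hasGoodReductionAt_mk_iff [IsAlgClosed K] {φ : ProjMorphism K N d}
    {Φ : PolyMap K N} (hΦ : IsMinimalLift φ Φ) (x : Fin (N + 1) → K) (hx : x ≠ 0) :
    HasGoodReductionAt φ (Projectivization.mk K x hx) ↔ ‖Φ.app x‖ = ‖x‖ ^ d := by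
  constructor
  · rintro ⟨Ψ, y, hy, hΨ, hmk, hy1, hΨ1, hΨy⟩
    obtain ⟨c, hc⟩ := hΦ.isLift.exists_eq_C_mul hΨ
    obtain ⟨a, ha⟩ := (Projectivization.mk_eq_mk_iff' K _ _ _ _).mp hmk.symm
    have hc1 : ‖c‖ = 1 := by
      rwa [coeffNorm_C_mul hc, hΦ.coeffNorm_eq_one, mul_one] at hΨ1
    have happ : Ψ.app y = c • Φ.app y := by
      funext i
      simp [PolyMap.app, hc]
    rw [happ, norm_smul, hc1, one_mul] at hΨy
    rw [← ha, PolyMap.app_smul hΦ.isLift.homogeneous, norm_smul, norm_smul, hΨy, hy1, norm_pow,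
      mul_one, mul_one]
  · intro h
    obtain ⟨c, hc, hcx⟩ := exists_norm_smul_eq_one hx
    refine ⟨Φ, c • x, smul_ne_zero hc hx, hΦ.isLift,
      (Projectivization.mk_eq_mk_iff' K _ _ _ _).mpr ⟨c, rfl⟩, hcx, hΦ.coeffNorm_eq_one, ?_⟩
    rw [PolyMap.app_smul hΦ.isLift.homogeneous, norm_smul, h, norm_pow, ← mul_pow, ← norm_smul,
      hcx, one_pow]

end NormedField

/-! ### Ultrametric estimates for integral polynomials and the chordal metric -/

section Ultrametric

variable [NormedField K] [IsUltrametricDist K]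

lemma norm_sub_le_max_norm (a b : K) : ‖a - b‖ ≤ max ‖a‖ ‖b‖ := by
  rw [sub_eq_add_neg, ← norm_neg b]
  exact IsUltrametricDist.norm_add_le_max a (-b)

lemma norm_eval_le {p : MvPolynomial (Fin (N + 1)) K} (hp : p.IsHomogeneous d)
    (hint : ∀ m, ‖p.coeff m‖ ≤ 1) (x : Fin (N + 1) → K) :
    ‖MvPolynomial.eval x p‖ ≤ ‖x‖ ^ d := by
  rw [MvPolynomial.eval_eq']
  refine IsUltrametricDist.norm_sum_le_of_forall_le_of_nonneg (by positivity) fun m hm => ?_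
  rw [norm_mul, ← sum_eq_of_coeff_ne_zero hp (MvPolynomial.mem_support_iff.mp hm)]
  exact (mul_le_of_le_one_left (norm_nonneg _) (hint m)).trans (norm_prod_pow_le m)

lemma norm_mul_sub_mul_le {a b a' b' : K} {δ : ℝ} (ha : ‖a - a'‖ ≤ δ) (hb : ‖b - b'‖ ≤ δ)
    (hb1 : ‖b‖ ≤ 1) (ha1 : ‖a'‖ ≤ 1) : ‖a * b - a' * b'‖ ≤ δ := by
  rw [show a * b - a' * b' = (a - a') * b + a' * (b - b') by ring]
  refine (IsUltrametricDist.norm_add_le_max _ _).trans (max_le ?_ ?_)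
  · rw [norm_mul]
    exact (mul_le_of_le_one_right (norm_nonneg _) hb1).trans ha
  · rw [norm_mul]
    exact (mul_le_of_le_one_left (norm_nonneg _) ha1).trans hb

lemma norm_prod_sub_prod_le {ι : Type*} (s : Finset ι) {f g : ι → K} {δ : ℝ} (hδ : 0 ≤ δ)
    (hf : ∀ i ∈ s, ‖f i‖ ≤ 1) (hg : ∀ i ∈ s, ‖g i‖ ≤ 1) (hfg : ∀ i ∈ s, ‖f i - g i‖ ≤ δ) :
    ‖∏ i ∈ s, f i - ∏ i ∈ s, g i‖ ≤ δ := by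
  classical
  induction s using Finset.induction_on with
  | empty => simpa using hδ
  | insert i s hi ih =>
    rw [Finset.prod_insert hi, Finset.prod_insert hi]
    refine norm_mul_sub_mul_le (hfg i (Finset.mem_insert_self i s))
      (ih (fun j hj => hf j (Finset.mem_insert_of_mem hj))
        (fun j hj => hg j (Finset.mem_insert_of_mem hj))
        fun j hj => hfg j (Finset.mem_insert_of_mem hj)) ?_ (hg i (Finset.mem_insert_self i s))
    rw [norm_prod]
    exact Finset.prod_le_one (fun _ _ => norm_nonneg _)
      fun j hj => hf j (Finset.mem_insert_of_mem hj)

/-- A polynomial with integral coefficients is nonexpanding on the closed unit polydisc. -/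
lemma norm_eval_sub_eval_le {p : MvPolynomial (Fin (N + 1)) K} (hint : ∀ m, ‖p.coeff m‖ ≤ 1)
    {x y : Fin (N + 1) → K} (hx : ‖x‖ ≤ 1) (hy : ‖y‖ ≤ 1) :
    ‖MvPolynomial.eval x p - MvPolynomial.eval y p‖ ≤ ‖x - y‖ := by
  have hx' : ∀ i, ‖x i‖ ≤ 1 := fun i => (norm_le_pi_norm x i).trans hx
  have hy' : ∀ i, ‖y i‖ ≤ 1 := fun i => (norm_le_pi_norm y i).trans hy
  rw [MvPolynomial.eval_eq', MvPolynomial.eval_eq', ← Finset.sum_sub_distrib]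
  refine IsUltrametricDist.norm_sum_le_of_forall_le_of_nonneg (norm_nonneg _) fun m _ => ?_
  rw [← mul_sub, norm_mul]
  refine (mul_le_of_le_one_left (norm_nonneg _) (hint m)).trans ?_
  refine norm_prod_sub_prod_le _ (norm_nonneg _) (fun i _ => ?_) (fun i _ => ?_) fun i _ => ?_
  · rw [norm_pow]; exact pow_le_one₀ (norm_nonneg _) (hx' i)
  · rw [norm_pow]; exact pow_le_one₀ (norm_nonneg _) (hy' i)
  · simpa using norm_prod_sub_prod_le (Finset.range (m i)) (f := fun _ => x i) (g := fun _ => y i)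
      (norm_nonneg (x - y)) (fun _ _ => hx' i) (fun _ _ => hy' i)
      fun _ _ => norm_le_pi_norm (x - y) i

variable {φ : ProjMorphism K N d} {Φ : PolyMap K N}

lemma IsMinimalLift.norm_app_le (hΦ : IsMinimalLift φ Φ) (x : Fin (N + 1) → K) :
    ‖Φ.app x‖ ≤ ‖x‖ ^ d :=
  (pi_norm_le_iff_of_nonneg (by positivity)).mpr fun i =>
    norm_eval_le (hΦ.isLift.homogeneous i) (hΦ.integral i) x

lemma IsMinimalLift.norm_app_sub_app_le (hΦ : IsMinimalLift φ Φ) {x y : Fin (N + 1) → K}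
    (hx : ‖x‖ ≤ 1) (hy : ‖y‖ ≤ 1) : ‖Φ.app x - Φ.app y‖ ≤ ‖x - y‖ :=
  (pi_norm_le_iff_of_nonneg (norm_nonneg _)).mpr fun i =>
    norm_eval_sub_eval_le (hΦ.integral i) hx hy

/-- The resultant of a system of forms with integral coefficients is integral. -/
lemma IsMinimalLift.norm_res_le_one (hΦ : IsMinimalLift φ Φ) : ‖Φ.res d‖ ≤ 1 := by
  unfold PolyMap.res
  rw [MvPolynomial.eval₂_eq]
  refine IsUltrametricDist.norm_sum_le_of_forall_le_of_nonneg zero_le_one fun m _ => ?_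
  rw [norm_mul, norm_prod]
  refine mul_le_one₀ (IsUltrametricDist.norm_intCast_le_one K _)
    (Finset.prod_nonneg fun _ _ => norm_nonneg _)
    (Finset.prod_le_one (fun _ _ => norm_nonneg _) fun c _ => ?_)
  rw [norm_pow]
  exact pow_le_one₀ (norm_nonneg _) (hΦ.integral _ _)

lemma dist_mk (x y : Fin (N + 1) → K) (hx : x ≠ 0) (hy : y ≠ 0) :
    dist (Projectivization.mk K x hx) (Projectivization.mk K y hy) = chordalVec x y :=
  chordalDist_mk x y hx hy

instance instIsUltrametricDistPSpace : IsUltrametricDist (PSpace K N) where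
  dist_triangle_max P Q R :=
    chordalVec_triangle P.rep Q.rep R.rep P.rep_nonzero Q.rep_nonzero R.rep_nonzero

lemma chordalVec_le_norm_sub {x y : Fin (N + 1) → K} (hx : ‖x‖ = 1) (hy : ‖y‖ = 1) :
    chordalVec x y ≤ ‖x - y‖ := by
  unfold chordalVec
  rw [hx, hy, mul_one, div_one]
  refine (pi_norm_le_iff_of_nonneg (norm_nonneg _)).mpr ?_
  rintro ⟨i, j⟩
  have hy' : ∀ i, ‖y i‖ ≤ 1 := fun i => hy ▸ norm_le_pi_norm y i
  have h : ∀ i j, ‖(x i - y i) * y j‖ ≤ ‖x - y‖ := fun i j => by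
    rw [norm_mul]
    exact (mul_le_of_le_one_right (norm_nonneg _) (hy' j)).trans (norm_le_pi_norm (x - y) i)
  rw [show x i * y j - x j * y i = (x i - y i) * y j - (x j - y j) * y i by ring]
  exact (norm_sub_le_max_norm _ _).trans (max_le (h i j) (h j i))

/-- A point at chordal distance less than `1` from `[x]`, where `‖x‖ = 1`, has a unit lift whose
distance to `x` is the chordal distance. -/
lemma exists_lift_norm_sub_le {x : Fin (N + 1) → K} (hx : x ≠ 0) (hx1 : ‖x‖ = 1)
    {Q : PSpace K N} (hQ : dist (Projectivization.mk K x hx) Q < 1) :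
    ∃ (y : Fin (N + 1) → K) (hy : y ≠ 0), Projectivization.mk K y hy = Q ∧ ‖y‖ = 1 ∧
      ‖x - y‖ ≤ dist (Projectivization.mk K x hx) Q := by
  obtain ⟨y, hy, rfl, hy1⟩ := exists_mk_eq_norm_eq_one Q
  have hpair : ∀ i j, ‖x i * y j - x j * y i‖
      ≤ dist (Projectivization.mk K x hx) (Projectivization.mk K y hy) := fun i j => by
    rw [dist_mk, chordalVec, hx1, hy1, mul_one, div_one]
    exact norm_le_pi_norm
      (fun p : Fin (N + 1) × Fin (N + 1) => x p.1 * y p.2 - x p.2 * y p.1) (i, j)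
  obtain ⟨j, hj⟩ := exists_norm_apply_eq x
  rw [hx1] at hj
  have hx' : ∀ i, ‖x i‖ ≤ 1 := fun i => hx1 ▸ norm_le_pi_norm x i
  -- If `|y j| < 1`, pick `i` with `|y i| = 1`: then `x j * y i` has absolute value 1 and dominates
  -- its minor, contradicting distance less than 1.
  have hyj : ‖y j‖ = 1 := by
    refine le_antisymm (hy1 ▸ norm_le_pi_norm y j) (not_lt.mp fun hlt => ?_)
    obtain ⟨i, hi⟩ := exists_norm_apply_eq y
    rw [hy1] at hi
    have h1 : ‖x j * y i‖ < 1 := by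
      rw [show x j * y i = x i * y j - (x i * y j - x j * y i) by ring]
      refine (norm_sub_le_max_norm _ _).trans_lt (max_lt ?_ ((hpair i j).trans_lt hQ))
      rw [norm_mul]
      exact (mul_le_of_le_one_left (norm_nonneg _) (hx' i)).trans_lt hlt
    rw [norm_mul, hj, hi, mul_one] at h1
    exact lt_irrefl _ h1
  have hyj0 : y j ≠ 0 := norm_ne_zero_iff.mp (hyj ▸ one_ne_zero)
  have hxj0 : x j ≠ 0 := norm_ne_zero_iff.mp (hj ▸ one_ne_zero)
  -- This scaling by a unit makes the `j`-th coordinates agree, so each coordinate of the difference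
  -- is a minor divided by `y j`.
  refine ⟨(x j / y j) • y, smul_ne_zero (div_ne_zero hxj0 hyj0) hy,
    (Projectivization.mk_eq_mk_iff' K _ _ _ _).mpr ⟨_, rfl⟩, ?_, ?_⟩
  · rw [norm_smul, norm_div, hj, hyj, hy1, div_one, mul_one]
  · refine (pi_norm_le_iff_of_nonneg dist_nonneg).mpr fun i => ?_
    have : (x - (x j / y j) • y) i = (x i * y j - x j * y i) / y j := by
      simp only [Pi.sub_apply, Pi.smul_apply, smul_eq_mul]
      field_simp
    rw [this, norm_div, hyj, div_one]
    exact hpair i j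

/-! ### Dynamics on unit discs around points of orbital good reduction -/

variable [IsAlgClosed K]

/-- On the open chordal disc of radius `1` around a point of good reduction, `φ` has good reduction
and does not increase the distance to the centre. -/
lemma IsMinimalLift.good_and_dist_le (hΦ : IsMinimalLift φ Φ) {P Q : PSpace K N}
    (hP : P ∈ goodSet φ) (hPQ : dist P Q < 1) :
    Q ∈ goodSet φ ∧ dist (φ P) (φ Q) ≤ dist P Q := by
  obtain ⟨x, hx, rfl, hx1⟩ := exists_mk_eq_norm_eq_one P
  obtain ⟨y, hy, rfl, hy1, hxy⟩ := exists_lift_norm_sub_le hx hx1 hPQ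
  have hΦx : ‖Φ.app x‖ = 1 := by
    rw [(hasGoodReductionAt_mk_iff hΦ x hx).mp hP, hx1, one_pow]
  have hle := hΦ.norm_app_sub_app_le hx1.le hy1.le
  -- `Φ(x)` has norm 1 and `Φ(x) - Φ(y)` has norm less than 1, so `Φ(y)` cannot be smaller than 1.
  have hΦy : ‖Φ.app y‖ = 1 := by
    refine le_antisymm (by simpa [hy1] using hΦ.norm_app_le y) (not_lt.mp fun hlt => ?_)
    obtain ⟨i, hi⟩ := exists_norm_apply_eq (Φ.app x)
    have h1 : ‖Φ.app x i‖ < 1 := by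
      rw [show Φ.app x i = (Φ.app x - Φ.app y) i + Φ.app y i by simp]
      exact (IsUltrametricDist.norm_add_le_max _ _).trans_lt (max_lt
        ((norm_le_pi_norm _ i).trans_lt ((hle.trans hxy).trans_lt hPQ))
        ((norm_le_pi_norm _ i).trans_lt hlt))
    exact absurd (hi.trans hΦx) h1.ne
  refine ⟨(hasGoodReductionAt_mk_iff hΦ y hy).mpr (by rw [hΦy, hy1, one_pow]), ?_⟩
  rw [hΦ.isLift.map_mk, hΦ.isLift.map_mk, dist_mk]
  exact (chordalVec_le_norm_sub hΦx hΦy).trans (hle.trans hxy)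

lemma IsMinimalLift.iterate_good_and_dist_le (hΦ : IsMinimalLift φ Φ) {P Q : PSpace K N}
    (hP : P ∈ orbitalGoodSet φ) (hPQ : dist P Q < 1) (n : ℕ) :
    φ^[n] Q ∈ goodSet φ ∧ dist (φ^[n] P) (φ^[n] Q) ≤ dist P Q := by
  have hdist : dist (φ^[n] P) (φ^[n] Q) ≤ dist P Q := by
    induction n with
    | zero => exact le_rfl
    | succ n ih =>
      rw [Function.iterate_succ_apply', Function.iterate_succ_apply']
      exact (hΦ.good_and_dist_le (hP n) (ih.trans_lt hPQ)).2.trans ih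
  exact ⟨(hΦ.good_and_dist_le (hP n) (hdist.trans_lt hPQ)).1, hdist⟩

lemma IsMinimalLift.ball_subset_orbitalGoodSet (hΦ : IsMinimalLift φ Φ) {P : PSpace K N}
    (hP : P ∈ orbitalGoodSet φ) : Metric.ball P 1 ⊆ orbitalGoodSet φ := fun Q hQ n =>
  (hΦ.iterate_good_and_dist_le hP (by rwa [dist_comm]) n).1

/-- Every point of an ultrametric disc is a centre: `Q` has orbital good reduction and `R` lies in
its unit disc. -/
lemma IsMinimalLift.dist_iterate_le (hΦ : IsMinimalLift φ Φ) {P Q R : PSpace K N}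
    (hP : P ∈ orbitalGoodSet φ) (hQ : Q ∈ Metric.ball P 1) (hR : R ∈ Metric.ball P 1) (n : ℕ) :
    dist (φ^[n] Q) (φ^[n] R) ≤ dist Q R := by
  refine (hΦ.iterate_good_and_dist_le (hΦ.ball_subset_orbitalGoodSet hP hQ) ?_ n).2
  exact (dist_triangle_max Q P R).trans_lt (max_lt hQ (by rwa [dist_comm]))

lemma IsMinimalLift.isOpen_orbitalGoodSet (hΦ : IsMinimalLift φ Φ) :
    IsOpen (orbitalGoodSet φ) :=
  Metric.isOpen_iff.mpr fun _ hP => ⟨1, one_pos, hΦ.ball_subset_orbitalGoodSet hP⟩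

lemma IsMinimalLift.orbitalGoodSet_subset_fatouSet (hΦ : IsMinimalLift φ Φ) :
    orbitalGoodSet φ ⊆ fatouSet φ := fun P hP => by
  refine ⟨orbitalGoodSet φ, ⟨hΦ.isOpen_orbitalGoodSet, fun Q hQ => ?_⟩, hP⟩
  refine Metric.equicontinuousAt_iff.mpr fun ε hε => ⟨min ε 1, lt_min hε one_pos, fun R hR n => ?_⟩
  rw [dist_comm] at hR
  exact (hΦ.iterate_good_and_dist_le hQ (hR.trans_le (min_le_right _ _)) n).2.trans_lt
    (hR.trans_le (min_le_left _ _))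

end Ultrametric

/-! ### The lower bound for a lift -/

/-- By the Nullstellensatz, a power of each variable lies in the ideal generated by forms without a
nontrivial common zero. -/
lemma exists_sum_mul_eq_X_pow [Field K] [IsAlgClosed K] {Φ : PolyMap K N}
    (hΦ : ∀ x, x ≠ 0 → Φ.app x ≠ 0) (j : Fin (N + 1)) :
    ∃ (k : ℕ) (G : PolyMap K N), ∑ i, G i * Φ i = MvPolynomial.X j ^ k := by
  have hmem : (MvPolynomial.X j : MvPolynomial (Fin (N + 1)) K)
      ∈ (Ideal.span (Set.range Φ)).radical := by
    rw [← MvPolynomial.vanishingIdeal_zeroLocus_eq_radical (K := K),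
      MvPolynomial.mem_vanishingIdeal_iff]
    intro x hx
    -- The common zero locus lies in `{0}`, where every variable vanishes.
    have hx0 : x = 0 := by
      by_contra h
      refine hΦ x h (funext fun i => ?_)
      have := MvPolynomial.mem_zeroLocus_iff.mp hx _ (Ideal.subset_span ⟨i, rfl⟩)
      rwa [MvPolynomial.aeval_eq_eval] at this
    simp [hx0]
  obtain ⟨k, hk⟩ := hmem
  exact ⟨k, Ideal.mem_span_range_iff_exists_fun.mp hk⟩

section NormedField

variable [NormedField K]

lemma exists_norm_eval_le (p : MvPolynomial (Fin (N + 1)) K) :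
    ∃ C : ℝ, ∀ x : Fin (N + 1) → K, ‖x‖ ≤ 1 → ‖MvPolynomial.eval x p‖ ≤ C := by
  refine ⟨∑ m ∈ p.support, ‖p.coeff m‖, fun x hx => ?_⟩
  rw [MvPolynomial.eval_eq']
  refine (norm_sum_le _ _).trans (Finset.sum_le_sum fun m _ => ?_)
  rw [norm_mul]
  exact mul_le_of_le_one_right (norm_nonneg _)
    ((norm_prod_pow_le m).trans (pow_le_one₀ (norm_nonneg _) hx))

variable [IsAlgClosed K] {φ : ProjMorphism K N d} {Φ : PolyMap K N}

/-- At a unit vector with `|x j| = 1`, evaluating `∑ G j i * Φ i = X j ^ k j` gives 1, while the `G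
j i` are bounded on the polydisc; homogeneity does the rest. -/
lemma IsLift.exists_le_norm_app {f : PSpace K N → PSpace K N} (hΦ : IsLift d Φ f) :
    ∃ ε : ℝ, 0 < ε ∧ ∀ x, x ≠ 0 → ε * ‖x‖ ^ d ≤ ‖Φ.app x‖ := by
  choose k G hG using exists_sum_mul_eq_X_pow hΦ.app_ne_zero
  choose C hC using fun p : MvPolynomial (Fin (N + 1)) K => exists_norm_eval_le p
  have hC0 : ∀ p, 0 ≤ C p := fun p =>
    (norm_nonneg _).trans (hC p 0 (by simp))
  set B : ℝ := 1 + ∑ j, ∑ i, C (G j i) with hB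
  have hBpos : 0 < B := by
    have : 0 ≤ ∑ j, ∑ i, C (G j i) :=
      Finset.sum_nonneg fun j _ => Finset.sum_nonneg fun i _ => hC0 _
    linarith
  have hunit : ∀ x : Fin (N + 1) → K, ‖x‖ = 1 → B⁻¹ ≤ ‖Φ.app x‖ := fun x hx => by
    obtain ⟨j, hj⟩ := exists_norm_apply_eq x
    have h1 : ‖∑ i, MvPolynomial.eval x (G j i) * Φ.app x i‖ = 1 := by
      have := congrArg (MvPolynomial.eval x) (hG j)
      simp only [map_sum, map_mul, map_pow, MvPolynomial.eval_X] at this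
      change ‖∑ i, MvPolynomial.eval x (G j i) * MvPolynomial.eval x (Φ i)‖ = 1
      rw [this, norm_pow, hj, hx, one_pow]
    have h2 : ‖∑ i, MvPolynomial.eval x (G j i) * Φ.app x i‖ ≤ (∑ i, C (G j i)) * ‖Φ.app x‖ := by
      rw [Finset.sum_mul]
      refine (norm_sum_le _ _).trans (Finset.sum_le_sum fun i _ => ?_)
      rw [norm_mul]
      exact mul_le_mul (hC _ x hx.le) (norm_le_pi_norm _ i) (norm_nonneg _) (hC0 _)
    have h3 : ∑ i, C (G j i) ≤ B := by
      have := Finset.single_le_sum (f := fun j => ∑ i, C (G j i))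
        (fun j _ => Finset.sum_nonneg fun i _ => hC0 (G j i)) (Finset.mem_univ j)
      linarith
    rw [inv_le_iff_one_le_mul₀' hBpos, ← h1]
    exact h2.trans (mul_le_mul_of_nonneg_right h3 (norm_nonneg _))
  refine ⟨B⁻¹, inv_pos.mpr hBpos, fun x hx => ?_⟩
  obtain ⟨c, hc, hcx⟩ := exists_norm_smul_eq_one hx
  have h := hunit _ hcx
  rw [PolyMap.app_smul hΦ.homogeneous, norm_smul, norm_pow] at h
  rw [norm_smul] at hcx
  calc B⁻¹ * ‖x‖ ^ d ≤ ‖c‖ ^ d * ‖Φ.app x‖ * ‖x‖ ^ d :=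
        mul_le_mul_of_nonneg_right h (by positivity)
    _ = (‖c‖ * ‖x‖) ^ d * ‖Φ.app x‖ := by ring
    _ = ‖Φ.app x‖ := by rw [hcx, one_pow, one_mul]

lemma IsMinimalLift.log_norm_app_eq_iff (hΦ : IsMinimalLift φ Φ) {x : Fin (N + 1) → K}
    (hx : x ≠ 0) :
    Real.log ‖Φ.app x‖ = d * Real.log ‖x‖ ↔ Projectivization.mk K x hx ∈ goodSet φ := by
  have h1 : 0 < ‖Φ.app x‖ := norm_pos_iff.mpr (hΦ.isLift.app_ne_zero x hx)
  have h2 : 0 < ‖x‖ ^ d := pow_pos (norm_pos_iff.mpr hx) d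
  rw [← Real.log_pow]
  exact (Real.log_injOn_pos.eq_iff h1 h2).trans (hasGoodReductionAt_mk_iff hΦ x hx).symm

end NormedField

/-! ### Green functions and orbital good reduction -/

section Ultrametric

variable [NormedField K] [IsUltrametricDist K]

variable {φ : ProjMorphism K N d} {Φ : PolyMap K N}

lemma IsMinimalLift.log_norm_app_le (hΦ : IsMinimalLift φ Φ) {x : Fin (N + 1) → K} (hx : x ≠ 0) :
    Real.log ‖Φ.app x‖ ≤ d * Real.log ‖x‖ := by
  rw [← Real.log_pow]
  exact Real.log_le_log (norm_pos_iff.mpr (hΦ.isLift.app_ne_zero x hx)) (hΦ.norm_app_le x)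

lemma IsMinimalLift.antitone_log_norm_iterate (hd : 2 ≤ d) (hΦ : IsMinimalLift φ Φ)
    {x : Fin (N + 1) → K} (hx : x ≠ 0) :
    Antitone fun n : ℕ => Real.log ‖Φ.app^[n] x‖ / (d : ℝ) ^ n := by
  have hd0 : (0 : ℝ) < d := by positivity
  refine antitone_nat_of_succ_le fun n => ?_
  rw [Function.iterate_succ_apply', pow_succ', div_le_div_iff₀ (by positivity) (by positivity)]
  have h := hΦ.log_norm_app_le (hΦ.isLift.iterate_app_ne_zero hx n)
  have := mul_le_mul_of_nonneg_right h (pow_nonneg hd0.le n)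
  linarith

variable [IsAlgClosed K]

lemma IsMinimalLift.tendsto_greenFunction (hd : 2 ≤ d) (hΦ : IsMinimalLift φ Φ)
    {x : Fin (N + 1) → K} (hx : x ≠ 0) :
    Tendsto (fun n : ℕ => Real.log ‖Φ.app^[n] x‖ / (d : ℝ) ^ n) atTop
      (𝓝 (greenFunction d Φ x)) := by
  have hd2 : (2 : ℝ) ≤ d := by exact_mod_cast hd
  have hd0 : (0 : ℝ) < d := by linarith
  obtain ⟨ε, hε, hlow⟩ := hΦ.isLift.exists_le_norm_app
  have hstep : ∀ y, y ≠ 0 → d * Real.log ‖y‖ - |Real.log ε| ≤ Real.log ‖Φ.app y‖ := fun y hy => by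
    have hy' : 0 < ‖y‖ := norm_pos_iff.mpr hy
    have h := Real.log_le_log (by positivity) (hlow y hy)
    rw [Real.log_mul hε.ne' (by positivity), Real.log_pow] at h
    linarith [neg_abs_le (Real.log ε)]
  -- Subtracting `|log ε|` absorbs the loss at each step, since `d * |log ε| ≥ 2 * |log ε|`. This
  -- increasing sequence bounds the decreasing one from below.
  have hmono : Monotone fun n : ℕ => (Real.log ‖Φ.app^[n] x‖ - |Real.log ε|) / (d : ℝ) ^ n := by
    refine monotone_nat_of_le_succ fun n => ?_
    rw [Function.iterate_succ_apply', pow_succ', div_le_div_iff₀ (by positivity) (by positivity),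
      ← mul_assoc]
    refine mul_le_mul_of_nonneg_right ?_ (by positivity)
    have h1 := hstep _ (hΦ.isLift.iterate_app_ne_zero hx n)
    have h2 := mul_le_mul_of_nonneg_right hd2 (abs_nonneg (Real.log ε))
    linarith
  have hbdd : BddBelow (Set.range fun n : ℕ => Real.log ‖Φ.app^[n] x‖ / (d : ℝ) ^ n) := by
    refine ⟨Real.log ‖x‖ - |Real.log ε|, ?_⟩
    rintro _ ⟨n, rfl⟩
    have h := hmono (Nat.zero_le n)
    simp only [Function.iterate_zero, id_eq, pow_zero, div_one] at h
    exact h.trans (div_le_div_of_nonneg_right (by linarith [abs_nonneg (Real.log ε)])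
      (by positivity))
  have h := tendsto_atTop_ciInf (hΦ.antitone_log_norm_iterate hd hx) hbdd
  -- `greenFunction` is a `limUnder`, meaningful only once convergence is known.
  rwa [← h.limUnder_eq] at h

lemma IsMinimalLift.greenFunction_smul (hd : 2 ≤ d) (hΦ : IsMinimalLift φ Φ)
    {x : Fin (N + 1) → K} (hx : x ≠ 0) {c : K} (hc : c ≠ 0) :
    greenFunction d Φ (c • x) = greenFunction d Φ x + Real.log ‖c‖ := by
  have hd0 : (d : ℝ) ≠ 0 := by positivity
  refine tendsto_nhds_unique (hΦ.tendsto_greenFunction hd (smul_ne_zero hc hx)) ?_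
  refine ((hΦ.tendsto_greenFunction hd hx).add_const (Real.log ‖c‖)).congr fun n => ?_
  rw [PolyMap.iterate_app_smul hΦ.isLift.homogeneous, norm_smul, norm_pow,
    Real.log_mul (pow_ne_zero _ (norm_ne_zero_iff.mpr hc))
      (norm_ne_zero_iff.mpr (hΦ.isLift.iterate_app_ne_zero hx n)), Real.log_pow]
  push_cast
  field_simp
  ring

lemma IsMinimalLift.modifiedGreen_mk (hd : 2 ≤ d) (hΦ : IsMinimalLift φ Φ)
    (x : Fin (N + 1) → K) (hx : x ≠ 0) :
    modifiedGreen d Φ (Projectivization.mk K x hx) = greenFunction d Φ x - Real.log ‖x‖ := by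
  obtain ⟨a, ha⟩ := Projectivization.exists_smul_eq_mk_rep K x hx
  have ha' : (a : K) • x = (Projectivization.mk K x hx).rep := ha
  rw [modifiedGreen, ← ha', hΦ.greenFunction_smul hd hx a.ne_zero, norm_smul,
    Real.log_mul (norm_ne_zero_iff.mpr a.ne_zero) (norm_ne_zero_iff.mpr hx)]
  ring

lemma IsMinimalLift.greenFunction_le (hd : 2 ≤ d) (hΦ : IsMinimalLift φ Φ)
    {x : Fin (N + 1) → K} (hx : x ≠ 0) (n : ℕ) :
    greenFunction d Φ x ≤ Real.log ‖Φ.app^[n] x‖ / (d : ℝ) ^ n :=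
  (hΦ.antitone_log_norm_iterate hd hx).le_of_tendsto (hΦ.tendsto_greenFunction hd hx) n

/-- Bad reduction makes the first step of the decreasing sequence strict, and later terms cannot
recover the loss. -/
lemma IsMinimalLift.modifiedGreen_neg (hd : 2 ≤ d) (hΦ : IsMinimalLift φ Φ) {P : PSpace K N}
    (hP : P ∈ badSet φ) : modifiedGreen d Φ P < 0 := by
  obtain ⟨x, hx, rfl, -⟩ := exists_mk_eq_norm_eq_one P
  have hd0 : (0 : ℝ) < d := by positivity
  have hlt : Real.log ‖Φ.app x‖ < d * Real.log ‖x‖ :=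
    (hΦ.log_norm_app_le hx).lt_of_ne fun h => hP ((hΦ.log_norm_app_eq_iff hx).mp h)
  have h := hΦ.greenFunction_le hd hx 1
  rw [Function.iterate_one, pow_one] at h
  rw [hΦ.modifiedGreen_mk hd, sub_neg]
  exact h.trans_lt ((div_lt_iff₀' hd0).mpr hlt)

lemma IsMinimalLift.modifiedGreen_eq_zero_iff (hd : 2 ≤ d) (hΦ : IsMinimalLift φ Φ)
    (P : PSpace K N) : modifiedGreen d Φ P = 0 ↔ P ∈ orbitalGoodSet φ := by
  obtain ⟨x, hx, rfl, -⟩ := exists_mk_eq_norm_eq_one P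
  have hd0 : (0 : ℝ) < d := by positivity
  rw [hΦ.modifiedGreen_mk hd, sub_eq_zero]
  -- Good reduction at the `n`-th iterate is equality of terms `n` and `n + 1`. Full orbital good
  -- reduction is thus constancy, which for a decreasing sequence means that the limit equals the
  -- initial term `log ‖x‖`.
  have hgood : ∀ n, φ^[n] (Projectivization.mk K x hx) ∈ goodSet φ ↔
      Real.log ‖Φ.app^[n + 1] x‖ / (d : ℝ) ^ (n + 1) = Real.log ‖Φ.app^[n] x‖ / (d : ℝ) ^ n :=
    fun n => by
      rw [hΦ.isLift.iterate_mk hx, ← hΦ.log_norm_app_eq_iff, Function.iterate_succ_apply',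
        pow_succ', div_eq_iff (by positivity), div_mul_eq_mul_div, mul_left_comm,
        mul_div_assoc, mul_div_cancel_right₀ _ (by positivity)]
  constructor
  · intro h n
    have hconst : ∀ n, Real.log ‖Φ.app^[n] x‖ / (d : ℝ) ^ n = Real.log ‖x‖ := fun n => by
      refine le_antisymm ?_ (h ▸ hΦ.greenFunction_le hd hx n)
      simpa using hΦ.antitone_log_norm_iterate hd hx (Nat.zero_le n)
    rw [hgood, hconst, hconst]
  · intro h
    have hconst : ∀ n, Real.log ‖Φ.app^[n] x‖ / (d : ℝ) ^ n = Real.log ‖x‖ := fun n => by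
      induction n with
      | zero => simp
      | succ n ih => rw [(hgood n).mp (h n), ih]
    have ht := hΦ.tendsto_greenFunction hd hx
    simp only [hconst] at ht
    exact tendsto_nhds_unique ht tendsto_const_nhds

end Ultrametric

end ProjDyn

/-! ### Assembly of the statements -/

theorem proposition32 {K : Type*} [NontriviallyNormedField K] [IsUltrametricDist K]
    [CompleteSpace K] [IsAlgClosed K] {N d : ℕ} (hd : 2 ≤ d)
    (φ : ProjDyn.ProjMorphism K N d) (Φ : ProjDyn.PolyMap K N)
    (hΦ : ProjDyn.IsMinimalLift φ Φ) :
    -- the limit defining the Green function exists, and the modified Green function may be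
    -- computed from any lift of a point
    (∀ (x : Fin (N + 1) → K) (hx : x ≠ 0),
      Tendsto (fun n : ℕ => Real.log ‖Φ.app^[n] x‖ / (d : ℝ) ^ n) atTop
        (𝓝 (ProjDyn.modifiedGreen d Φ (Projectivization.mk K x hx) + Real.log ‖x‖))) ∧
    -- (a)
    (∀ P ∈ ProjDyn.orbitalGoodSet φ, ∀ Q ∈ Metric.ball P ‖Φ.res d‖,
      ∀ R ∈ Metric.ball P ‖Φ.res d‖, ∀ n : ℕ, 1 ≤ n →
        dist (φ^[n] Q) (φ^[n] R) ≤ dist Q R) ∧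
    -- (b)
    ((∀ P ∈ ProjDyn.orbitalGoodSet φ,
        Metric.ball P ‖Φ.res d‖ ⊆ ProjDyn.orbitalGoodSet φ) ∧
      IsOpen (ProjDyn.orbitalGoodSet φ)) ∧
    -- (c)
    (ProjDyn.orbitalGoodSet φ = {P | ProjDyn.modifiedGreen d Φ P = 0} ∧
      ProjDyn.orbitalGoodSet φ ⊆ ProjDyn.fatouSet φ) ∧
    -- (d)
    (∀ P ∈ ProjDyn.badSet φ, ProjDyn.modifiedGreen d Φ P < 0) ∧
    -- (e)
    IsOpen {P | ProjDyn.modifiedGreen d Φ P = 0} := by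
  have hball : ∀ P : ProjDyn.PSpace K N, Metric.ball P ‖Φ.res d‖ ⊆ Metric.ball P 1 :=
    fun _ => Metric.ball_subset_ball hΦ.norm_res_le_one
  have hc : ProjDyn.orbitalGoodSet φ = {P | ProjDyn.modifiedGreen d Φ P = 0} :=
    Set.ext fun P => (hΦ.modifiedGreen_eq_zero_iff hd P).symm
  refine ⟨fun x hx => ?_, fun P hP Q hQ R hR n _ => hΦ.dist_iterate_le hP (hball P hQ) (hball P hR) n,
    ⟨fun P hP => (hball P).trans (hΦ.ball_subset_orbitalGoodSet hP), hΦ.isOpen_orbitalGoodSet⟩,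
    ⟨hc, hΦ.orbitalGoodSet_subset_fatouSet⟩, fun P hP => hΦ.modifiedGreen_neg hd hP,
    hc ▸ hΦ.isOpen_orbitalGoodSet⟩
  rw [hΦ.modifiedGreen_mk hd, sub_add_cancel]
  exact hΦ.tendsto_greenFunction hd hx
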